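/- Let $H_1$ be the Tilley graph, i.e. the 12-vertex graph with 29 edges obtained from the icosahedral graph by deleting one edge. (The icosahedral graph has vertices $0,\dots,11$; vertex $0$ is joined to $1,\dots,5$ and vertex $11$ to $6,\dots,10$; $1,\dots,5$ and $6,\dots,10$ are 5-cycles; and $i\in\{1,\dots,5\}$ is joined to $i+5$ and $i+6$, where $11$ is read as $6$ for $i=5$. It is edge-transitive; we delete the edge $\{0,1\}$.) For a graph $G$ on $n$ vertices with adjacency eigenvalues $\lambda_1\ge\dots\ge\lambda_n$, and $p\ge 0$, put $\mathcal E_p^+(G)=\sum_{\lambda_i>0}\lambda_i^p$, $\mathcal E_p^-(G)=\sum_{\lambda_i<0}|\lambda_i|^p$, let $n^+$ and $n^-$ be the numbers of positive and of negative eigenvalues, and for $p\neq 1$ put $$f(p;G)=1+\max\left\{\frac{\mathcal E_p^+(G)}{\mathcal E_p^-(G)},\frac{\mathcal E_p^-(G)}{\mathcal E_p^+(G)}\right\}^{1/|p-1|}.$$ The quantum chromatic number $\chi_q(G)$ is the least $r$ for which there are a dimension $d>0$ and orthogonal projectors $P_{v,k}\in\mathbb C^{d\times d}$ ($v\in V(G)$,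 $1\le k\le r$) with $\sum_{k}P_{v,k}=I$ for every vertex $v$ and $P_{v,k}P_{w,k}=0$ for every edge $vw$ and every $k$. Then the following hold. 1. $H_1$ is not regular, its clique number is $\omega(H_1)=3$, its chromatic number is $\chi(H_1)=4$, and its eigenvalues in non-increasing order are $$4.86272,\ 1+\sqrt2,\ \sqrt5,\ 1.90542,\ 1-\sqrt2,\ -1,\ -1,\ -1,\ -1.32557,\ -2,\ -\sqrt5,\ -2.44258,$$ where the four decimal values are correct up to an error of at most $5\cdot10^{-6}$ and the others are exact. 2. The earlier spectral lower bounds give only $\chi_q(H_1)\ge3$. The Hoffman bound is $1+\frac{\lambda_1}{-\lambda_{12}}\approx 2.99082$ (error at most $5\cdot 10^{-6}$), and it is the largest of the numbers $1+\frac{\sum_{i=1}^m\lambda_i}{-\sum_{i=1}^m\lambda_{12-i+1}}$ with $1\le m\le 11$; the square-energy bound $1+\max\{\mathcal E_2^+/\mathcal E_2^-,\mathcal E_2^- /\mathcal E_2^+\}$, like the Hoffman bound, has ceiling $3$; and the inertia bound $1+\max\{n^+/n^-,n^- /n^+\}$ equals $3$. 3. For $p=13.3466$ one has $f(p;H_1)\approx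 3.05114$ (error at most $5\cdot10^{-6}$), which exceeds $3$, so that $\lceil f(p;H_1)\rceil=4\le\chi_q(H_1)$. 4. $\chi_q(H_1)=4$. -/

import Mathlib

open scoped Matrix

noncomputable section

namespace SimpleGraph

/-! ### Quantum colourings -/

/-- A quantum `r`-colouring of `G` in dimension `d`: orthogonal projectors `P v k` (self-adjoint
idempotents) in `ℂ^{d × d}`, complete at every vertex and orthogonal along every edge. -/
structure IsQuantumColoring {V : Type*} (G : SimpleGraph V) {r d : ℕ}
    (P : V → Fin r → Matrix (Fin d) (Fin d) ℂ) : Prop where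
  projector : ∀ v k, IsStarProjection (P v k)
  completeness : ∀ v, ∑ k, P v k = 1
  orthogonality : ∀ v w, G.Adj v w → ∀ k, P v k * P w k = 0

/-- `G` admits a quantum `r`-colouring in some dimension `d > 0`. -/
def QuantumColorable {V : Type*} (G : SimpleGraph V) (r : ℕ) : Prop :=
  ∃ d : ℕ, 0 < d ∧ ∃ P : V → Fin r → Matrix (Fin d) (Fin d) ℂ, G.IsQuantumColoring P

/-- The quantum chromatic number: the smallest `r` such that `G` is quantum `r`-colourable
(`⊤` if there is none, as for Mathlib's `SimpleGraph.chromaticNumber`). -/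
def quantumChromaticNumber {V : Type*} (G : SimpleGraph V) : ℕ∞ :=
  ⨅ r ∈ {r : ℕ | G.QuantumColorable r}, (r : ℕ∞)

/-! ### Adjacency eigenvalues, energies and the spectral bounds -/

section Spectral

variable {n : ℕ} (G : SimpleGraph (Fin n)) [DecidableRel G.Adj]

/-- The eigenvalues of the adjacency matrix with multiplicity, in non-increasing order;
`G.adjEigenvalue i` is what is usually written `λ_{i+1}(G)`. -/
def adjEigenvalue (i : Fin n) : ℝ :=
  (G.isHermitian_adjMatrix ℝ).eigenvalues₀ (Fin.cast (Fintype.card_fin n).symm i)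

/-- The positive `p`-energy. -/
def posEnergy (p : ℝ) : ℝ :=
  ∑ i : Fin n with 0 < G.adjEigenvalue i, G.adjEigenvalue i ^ p

/-- The negative `p`-energy. -/
def negEnergy (p : ℝ) : ℝ :=
  ∑ i : Fin n with G.adjEigenvalue i < 0, |G.adjEigenvalue i| ^ p

/-- The larger of the two quotients of the positive and the negative `p`-energy. -/
def energyRatio (p : ℝ) : ℝ :=
  max (G.posEnergy p / G.negEnergy p) (G.negEnergy p / G.posEnergy p)

/-- The `p`-energy bound `f(p; G)`. -/
def pEnergyBound (p : ℝ) : ℝ := 1 + G.energyRatio p ^ (1 / |p - 1|)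

/-- The number of positive adjacency eigenvalues. -/
def posInertia : ℕ := (Finset.univ.filter fun i : Fin n => 0 < G.adjEigenvalue i).card

/-- The number of negative adjacency eigenvalues. -/
def negInertia : ℕ := (Finset.univ.filter fun i : Fin n => G.adjEigenvalue i < 0).card

/-- The inertia bound of Elphick and Wocjan. -/
def inertiaBound : ℝ :=
  1 + max ((G.posInertia : ℝ) / G.negInertia) ((G.negInertia : ℝ) / G.posInertia)

/-- The square-energy bound of Ando and Lin. -/
def squareEnergyBound : ℝ := 1 + G.energyRatio 2

/-- The bound of Wocjan and Elphick from the `m` largest and the `m` smallest eigenvalues;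
`m = 1` is the Hoffman bound. -/
def eigenvalueSumBound (m : ℕ) : ℝ :=
  1 + (∑ i : Fin n with i.val < m, G.adjEigenvalue i) /
    (-∑ i : Fin n with n ≤ i.val + m, G.adjEigenvalue i)

end Spectral

/-! ### The Tilley graph -/

/-- The 30 edges of the icosahedron: poles `0` and `11`, an upper 5-cycle `1, …, 5` joined to `0`,
a lower 5-cycle `6, …, 10` joined to `11`, and a zigzag of ten edges between the cycles. -/
def icosahedralEdges : Finset (Sym2 (Fin 12)) :=
  {s(0, 1), s(0, 2), s(0, 3), s(0, 4), s(0, 5),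
   s(1, 2), s(2, 3), s(3, 4), s(4, 5), s(5, 1),
   s(1, 6), s(2, 7), s(3, 8), s(4, 9), s(5, 10),
   s(1, 7), s(2, 8), s(3, 9), s(4, 10), s(5, 6),
   s(6, 7), s(7, 8), s(8, 9), s(9, 10), s(10, 6),
   s(11, 6), s(11, 7), s(11, 8), s(11, 9), s(11, 10)}

/-- The Tilley graph: the icosahedral graph with one edge deleted (the icosahedral graph is
edge-transitive, so the choice of the edge is immaterial). -/
def tilleyGraph : SimpleGraph (Fin 12) :=
  fromEdgeSet (↑(icosahedralEdges.erase s(0, 1)) : Set (Sym2 (Fin 12)))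

instance : DecidableRel tilleyGraph.Adj :=
  inferInstanceAs (DecidableRel
    (fromEdgeSet (↑(icosahedralEdges.erase s(0, 1)) : Set (Sym2 (Fin 12)))).Adj)

end SimpleGraph

end

/-! The quantum chromatic number is found without spectra. In a quantum colouring with at most three
colours, the projectors of one colour on a triangle are pairwise orthogonal, and a trace count over
the colours forces them to sum to `1`. Hence the two vertices opposite a common edge carry equal
projectors. Walking round the odd rim of a 5-wheel then makes two adjacent vertices carry equal
projectors, which must vanish, contradicting completeness (`not_quantumColorable_of_wheel`). The
wheel at vertex 11 survives the deletion, and an explicit 4-colouring gives the upper bound. The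
same two facts give the classical chromatic number.

The spectrum needs no characteristic polynomial. Explicit eigenvectors exhibit ten distinct
eigenvalues, four of them roots of a quartic; the traces of the adjacency matrix and of its square
force the remaining two to be `-1` (`tilleyGraph_adjEigenvalue`).

The spectral bounds are then interval arithmetic. Real powers are enclosed through Taylor bounds for
`exp` (`rpow_le_of_exp_approx`, `le_rpow_of_exp_approx`), and the root in the p-energy bound is
avoided by comparing the energy ratio with powers of the two target endpoints. -/

namespace SimpleGraph

/-! ### Quantum colourings, triangles and 5-wheels -/

open scoped ComplexOrder in
/-- Star projections whose sum is a nonpositive multiple of the identity all vanish. -/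
theorem isStarProjection_eq_zero_of_sum_eq {ι : Type*} [Fintype ι] {d : ℕ}
    {Q : ι → Matrix (Fin d) (Fin d) ℂ} (hQ : ∀ k, IsStarProjection (Q k)) {c : ℝ} (hc : c ≤ 0)
    (hsum : ∑ k, Q k = (c : ℂ) • 1) (k : ι) : Q k = 0 := by
  -- In this form the trace of `Q k` is visibly nonnegative, and zero only if `Q k = 0`.
  have hself : ∀ k, (Q k)ᴴ * Q k = Q k := fun k => by
    rw [← Matrix.star_eq_conjTranspose, (hQ k).isSelfAdjoint.star_eq, (hQ k).isIdempotentElem.eq]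
  have hnonneg : ∀ k, 0 ≤ (Q k).trace := fun k => by
    rw [← hself k]
    exact (Matrix.posSemidef_conjTranspose_mul_self _).trace_nonneg
  have htrace : ∑ k, (Q k).trace = ((c * d : ℝ) : ℂ) := by
    rw [← Matrix.trace_sum, hsum]
    simp
  have hzero : ∑ k, (Q k).trace = 0 := by
    refine le_antisymm ?_ (Finset.sum_nonneg fun k _ => hnonneg k)
    rw [htrace]
    exact_mod_cast mul_nonpos_of_nonpos_of_nonneg hc d.cast_nonneg
  have := (Finset.sum_eq_zero_iff_of_nonneg fun k _ => hnonneg k).1 hzero k (Finset.mem_univ k)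
  rw [← hself k] at this
  exact Matrix.trace_conjTranspose_mul_self_eq_zero_iff.1 this

section

variable {V : Type*} {G : SimpleGraph V} {r d : ℕ} {P : V → Fin r → Matrix (Fin d) (Fin d) ℂ}

/-- With at most three colours, the projectors of a given colour on a triangle sum to the
identity. -/
theorem IsQuantumColoring.add_add_eq_one (hP : G.IsQuantumColoring P) (hr : r ≤ 3) {u v w : V}
    (huv : G.Adj u v) (huw : G.Adj u w) (hvw : G.Adj v w) (k : Fin r) :
    P u k + P v k + P w k = 1 := by
  have hproj : ∀ k, IsStarProjection (1 - (P u k + P v k + P w k)) := fun k => by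
    refine (((hP.projector u k).add (hP.projector v k) (hP.orthogonality u v huv k)).add
      (hP.projector w k) ?_).one_sub
    rw [add_mul, hP.orthogonality u w huw k, hP.orthogonality v w hvw k, add_zero]
  have hsum : ∑ k, (1 - (P u k + P v k + P w k)) =
      (((r : ℝ) - 3 : ℝ) : ℂ) • (1 : Matrix (Fin d) (Fin d) ℂ) := by
    rw [Finset.sum_sub_distrib, Finset.sum_add_distrib, Finset.sum_add_distrib,
      hP.completeness, hP.completeness, hP.completeness]
    simp only [Finset.sum_const, Finset.card_univ, Fintype.card_fin, Complex.ofReal_sub,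
      Complex.ofReal_natCast, Complex.ofReal_ofNat, sub_smul, Nat.cast_smul_eq_nsmul]
    rw [show (3 : ℂ) • (1 : Matrix (Fin d) (Fin d) ℂ) = 1 + 1 + 1 by module]
  have hr' : (r : ℝ) - 3 ≤ 0 := by
    have : (r : ℝ) ≤ 3 := by exact_mod_cast hr
    linarith
  exact (sub_eq_zero.1 (isStarProjection_eq_zero_of_sum_eq hproj hr' hsum k)).symm

/-- With at most three colours, the two vertices completing an edge to triangles carry the same
projectors. -/
theorem IsQuantumColoring.eq_of_common_edge (hP : G.IsQuantumColoring P) (hr : r ≤ 3)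
    {u v w w' : V} (huv : G.Adj u v) (huw : G.Adj u w) (hvw : G.Adj v w) (huw' : G.Adj u w')
    (hvw' : G.Adj v w') : P w = P w' := by
  funext k
  exact add_left_cancel ((hP.add_add_eq_one hr huv huw hvw k).trans
    (hP.add_add_eq_one hr huv huw' hvw' k).symm)

/-- A graph that contains a 5-wheel with hub `h` and rim `a, b, c, d, e` is not quantum
`r`-colourable for `r ≤ 3`. -/
theorem not_quantumColorable_of_wheel {h a b c d e : V} (ha : G.Adj h a) (hb : G.Adj h b)
    (hc : G.Adj h c) (hd : G.Adj h d) (he : G.Adj h e) (hab : G.Adj a b) (hbc : G.Adj b c)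
    (hcd : G.Adj c d) (hde : G.Adj d e) (hea : G.Adj e a) (hr : r ≤ 3) :
    ¬ G.QuantumColorable r := by
  rintro ⟨n, hn, P, hP⟩
  -- The spoke `hb` lies in the triangles `hab` and `hbc`; the spoke `hd` serves `c` and `e`
  -- likewise.
  have hac : P a = P c := hP.eq_of_common_edge hr hb ha hab.symm hc hbc
  have hce : P c = P e := hP.eq_of_common_edge hr hd hc hcd.symm he hde
  have hzero : ∀ k, P a k = 0 := fun k => by
    have := hP.orthogonality e a hea k
    rwa [← hce, ← hac, (hP.projector a k).isIdempotentElem.eq] at this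
  have hone := hP.completeness a
  simp only [hzero, Finset.sum_const_zero] at hone
  have : NeZero n := ⟨hn.ne'⟩
  exact zero_ne_one hone

/-- A classical colouring is a quantum colouring in dimension one. -/
theorem Colorable.quantumColorable (h : G.Colorable r) : G.QuantumColorable r := by
  obtain ⟨C⟩ := h
  refine ⟨1, one_pos, fun v k => if C v = k then 1 else 0, ⟨fun v k => ?_, fun v => ?_,
    fun v w hvw k => ?_⟩⟩
  · split_ifs
    exacts [IsStarProjection.one _, IsStarProjection.zero _]
  · simp
  · have := C.valid hvw
    split_ifs with h1 h2
    · exact absurd (h1.trans h2.symm) this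
    all_goals simp

theorem quantumChromaticNumber_eq {m : ℕ} (hm : G.QuantumColorable m)
    (hlt : ∀ r < m, ¬ G.QuantumColorable r) : G.quantumChromaticNumber = m := by
  refine le_antisymm (iInf₂_le m hm) (le_iInf₂ fun r hr => ?_)
  by_contra h
  exact hlt r (by simpa using h) hr

end

/-! ### Combinatorics of the Tilley graph -/

/-- The neighbours of each vertex of the Tilley graph. -/
def tilleyNeighbors : Fin 12 → Finset (Fin 12) :=
  ![{2, 3, 4, 5}, {2, 5, 6, 7}, {0, 1, 3, 7, 8}, {0, 2, 4, 8, 9}, {0, 3, 5, 9, 10},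
    {0, 1, 4, 6, 10}, {1, 5, 7, 10, 11}, {1, 2, 6, 8, 11}, {2, 3, 7, 9, 11}, {3, 4, 8, 10, 11},
    {4, 5, 6, 9, 11}, {6, 7, 8, 9, 10}]

theorem tilleyGraph_adj_iff (v w : Fin 12) :
    tilleyGraph.Adj v w ↔ w ∈ tilleyNeighbors v := by
  revert v w
  decide

theorem tilleyGraph_not_quantumColorable {r : ℕ} (hr : r ≤ 3) :
    ¬ tilleyGraph.QuantumColorable r := by
  -- The pole opposite the deleted edge keeps all five spokes and its whole rim.
  refine not_quantumColorable_of_wheel (h := 11) (a := 6) (b := 7) (c := 8) (d := 9) (e := 10)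
    ?_ ?_ ?_ ?_ ?_ ?_ ?_ ?_ ?_ ?_ hr
  all_goals
    rw [tilleyGraph_adj_iff]
    decide

theorem tilleyGraph_colorable : tilleyGraph.Colorable 4 := by
  refine ⟨Coloring.mk ![0, 0, 1, 2, 1, 2, 1, 3, 0, 3, 0, 2] fun {v w} h => ?_⟩
  rw [tilleyGraph_adj_iff] at h
  revert v w
  decide

theorem tilleyGraph_quantumChromaticNumber : tilleyGraph.quantumChromaticNumber = 4 :=
  quantumChromaticNumber_eq tilleyGraph_colorable.quantumColorable fun _ hr =>
    tilleyGraph_not_quantumColorable (Nat.lt_succ_iff.1 hr)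

theorem tilleyGraph_chromaticNumber : tilleyGraph.chromaticNumber = 4 := by
  refine chromaticNumber_eq_iff_colorable_not_colorable.2 ⟨tilleyGraph_colorable, fun h => ?_⟩
  exact tilleyGraph_not_quantumColorable le_rfl h.quantumColorable

theorem tilleyGraph_cliqueFree : tilleyGraph.CliqueFree 4 := by
  rw [cliqueFree_iff]
  refine ⟨fun f => ?_⟩
  have hadj : ∀ i j : Fin 4, i ≠ j → tilleyGraph.Adj (f i) (f j) := fun i j h =>
    f.toHom.map_adj h
  -- Ranging over neighbourhoods instead of all quadruples keeps the finite check small.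
  have key : ∀ a, ∀ b ∈ tilleyNeighbors a, ∀ c ∈ tilleyNeighbors b, c ∈ tilleyNeighbors a →
      ∀ d ∈ tilleyNeighbors c, ¬ (d ∈ tilleyNeighbors a ∧ d ∈ tilleyNeighbors b) := by
    decide
  simp only [tilleyGraph_adj_iff] at hadj
  exact key _ _ (hadj 0 1 (by decide)) _ (hadj 1 2 (by decide)) (hadj 0 2 (by decide)) _
    (hadj 2 3 (by decide)) ⟨hadj 0 3 (by decide), hadj 1 3 (by decide)⟩

theorem tilleyGraph_cliqueNum : tilleyGraph.cliqueNum = 3 := by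
  refine le_antisymm ?_ ?_
  · obtain ⟨s, hs⟩ := exists_isNClique_cliqueNum (G := tilleyGraph)
    by_contra h
    exact tilleyGraph_cliqueFree.mono (not_le.1 h) s hs
  · have : tilleyGraph.IsNClique 3 {0, 2, 3} := by
      rw [is3Clique_triple_iff]
      simp only [tilleyGraph_adj_iff]
      decide
    rw [← this.card_eq]
    exact this.isClique.card_le_cliqueNum

theorem tilleyGraph_neighborFinset (v : Fin 12) :
    tilleyGraph.neighborFinset v = tilleyNeighbors v := by
  ext w
  rw [mem_neighborFinset, tilleyGraph_adj_iff]

theorem tilleyGraph_not_isRegular : ¬ ∃ d : ℕ, tilleyGraph.IsRegularOfDegree d := by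
  rintro ⟨d, hd⟩
  have h := (hd 0).trans (hd 2).symm
  rw [← card_neighborFinset_eq_degree, ← card_neighborFinset_eq_degree,
    tilleyGraph_neighborFinset, tilleyGraph_neighborFinset] at h
  revert h
  decide

end SimpleGraph

/-! ### Traces, eigenvectors and the ordered list of eigenvalues -/

/-- The trace of the square of a real symmetric matrix is the sum of the squares of its
eigenvalues. -/
theorem Matrix.IsHermitian.trace_mul_self_eq_sum_eigenvalues_sq {ι : Type*} [Fintype ι]
    [DecidableEq ι] {A : Matrix ι ι ℝ} (hA : A.IsHermitian) :
    (A * A).trace = ∑ i, hA.eigenvalues i ^ 2 := by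
  conv_lhs => rw [hA.spectral_theorem]
  rw [← map_mul, Unitary.conjStarAlgAut_apply, Matrix.trace_mul_comm, ← mul_assoc]
  simp [Matrix.trace, sq]

/-- A multiset with two elements more than a given submultiset is obtained by adding a pair. -/
theorem Multiset.exists_eq_add_pair_of_card {α : Type*} {s t : Multiset α} (hst : s ≤ t)
    (hcard : t.card = s.card + 2) : ∃ x y, t = s + {x, y} := by
  obtain ⟨u, rfl⟩ := Multiset.le_iff_exists_add.1 hst
  obtain ⟨x, y, rfl⟩ := Multiset.card_eq_two.1 (by simpa using hcard : u.card = 2)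
  exact ⟨x, y, rfl⟩

namespace SimpleGraph

section

variable {n : ℕ} (G : SimpleGraph (Fin n)) [DecidableRel G.Adj]

theorem adjEigenvalue_antitone : Antitone G.adjEigenvalue := fun _ _ h =>
  (G.isHermitian_adjMatrix ℝ).eigenvalues₀_antitone h

/-- Both families reindex `eigenvalues₀`, so trace identities carry over to the ordered list. -/
theorem sum_comp_adjEigenvalue (f : ℝ → ℝ) :
    ∑ i, f (G.adjEigenvalue i) = ∑ i, f ((G.isHermitian_adjMatrix ℝ).eigenvalues i) := by
  unfold adjEigenvalue Matrix.IsHermitian.eigenvalues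
  refine Eq.trans ?_ (Equiv.sum_comp (Fintype.equivOfCardEq (Fintype.card_fin _)).symm
    fun i => f ((G.isHermitian_adjMatrix ℝ).eigenvalues₀ i)).symm
  exact Equiv.sum_comp (finCongr (Fintype.card_fin n).symm)
    fun i => f ((G.isHermitian_adjMatrix ℝ).eigenvalues₀ i)

theorem sum_adjEigenvalue : ∑ i, G.adjEigenvalue i = 0 := by
  have h := (G.isHermitian_adjMatrix ℝ).trace_eq_sum_eigenvalues
  rw [trace_adjMatrix] at h
  exact (G.sum_comp_adjEigenvalue fun x => x).trans h.symm

theorem sum_adjEigenvalue_sq : ∑ i, G.adjEigenvalue i ^ 2 = ∑ v, (G.degree v : ℝ) := by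
  rw [G.sum_comp_adjEigenvalue fun x => x ^ 2,
    ← (G.isHermitian_adjMatrix ℝ).trace_mul_self_eq_sum_eigenvalues_sq]
  refine Finset.sum_congr rfl fun v _ => ?_
  rw [Matrix.diag_apply, adjMatrix_mul_self_apply_self]

theorem exists_adjEigenvalue_eq {v : Fin n → ℝ} {μ : ℝ} (hv : v ≠ 0)
    (h : G.adjMatrix ℝ *ᵥ v = μ • v) : ∃ i, G.adjEigenvalue i = μ := by
  have hμ : Module.End.HasEigenvalue (Matrix.toLin' (G.adjMatrix ℝ)) μ :=
    Module.End.hasEigenvalue_of_hasEigenvector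
      (Module.End.hasEigenvector_iff.2 ⟨Module.End.mem_eigenspace_iff.2 (by simpa using h), hv⟩)
  have hmem := hμ.mem_spectrum
  rw [Matrix.spectrum_toLin', (G.isHermitian_adjMatrix ℝ).spectrum_real_eq_range_eigenvalues]
    at hmem
  obtain ⟨i, hi⟩ := hmem
  exact ⟨Fin.cast (Fintype.card_fin n) _, hi⟩

/-- A non-increasing list with the same entries as the list of eigenvalues is that list. -/
theorem adjEigenvalue_eq_of_map_eq {f : Fin n → ℝ} (hf : Antitone f)
    (h : Finset.univ.val.map G.adjEigenvalue = Finset.univ.val.map f) : G.adjEigenvalue = f := by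
  rw [Fin.univ_val_map, Fin.univ_val_map, Multiset.coe_eq_coe] at h
  refine List.ofFn_injective (h.eq_of_pairwise' (r := (· ≥ ·)) ?_ ?_)
  · exact List.sortedGE_iff_pairwise.1 G.adjEigenvalue_antitone.sortedGE_ofFn
  · exact List.sortedGE_iff_pairwise.1 hf.sortedGE_ofFn

end

/-! ### Eigenvectors of the Tilley graph -/

theorem tilleyGraph_adjMatrix_mulVec (v : Fin 12 → ℝ) :
    tilleyGraph.adjMatrix ℝ *ᵥ v = ![v 2 + v 3 + v 4 + v 5, v 2 + v 5 + v 6 + v 7,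
      v 0 + v 1 + v 3 + v 7 + v 8, v 0 + v 2 + v 4 + v 8 + v 9, v 0 + v 3 + v 5 + v 9 + v 10,
      v 0 + v 1 + v 4 + v 6 + v 10, v 1 + v 5 + v 7 + v 10 + v 11, v 1 + v 2 + v 6 + v 8 + v 11,
      v 2 + v 3 + v 7 + v 9 + v 11, v 3 + v 4 + v 8 + v 10 + v 11, v 4 + v 5 + v 6 + v 9 + v 11,
      v 6 + v 7 + v 8 + v 9 + v 10] := by
  funext i
  rw [adjMatrix_mulVec_apply, tilleyGraph_neighborFinset]
  fin_cases i <;> simp [tilleyNeighbors, ← add_assoc]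

/-- The vector is constant on the orbits of the four-element group of automorphisms that preserves
the deleted edge. The quartic is needed only in the rows of vertices 9 and 11. -/
theorem tilleyGraph_exists_adjEigenvalue_of_quartic {x : ℝ}
    (hx : x ^ 4 - 3 * x ^ 3 - 13 * x ^ 2 + 13 * x + 30 = 0) :
    ∃ i, tilleyGraph.adjEigenvalue i = x := by
  refine exists_adjEigenvalue_eq _ (v := ![2 * (x + 5), 2 * (x + 5), 4 * x + 4, x ^ 2 + x - 4,
    x ^ 2 + x - 4, 4 * x + 4, x ^ 2 + x - 4, x ^ 2 + x - 4, 2 * x ^ 2 - 2 * x - 12,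
    x ^ 3 - 2 * x ^ 2 - 9 * x + 2, 2 * x ^ 2 - 2 * x - 12, x ^ 3 - 2 * x ^ 2 - 9 * x + 2])
    (fun h => ?_) ?_
  · have h0 := congrFun h 0
    simp only [Matrix.cons_val_zero, Pi.zero_apply] at h0
    have : x = -5 := by linarith
    norm_num [this] at hx
  · rw [tilleyGraph_adjMatrix_mulVec]
    funext i
    fin_cases i <;> simp <;> first | ring1 | linear_combination -hx

/-- The vector changes sign under the automorphism that swaps 0 and 1 and fixes 2 and 5. Rows 9 and
11 require `x ^ 3 - 5 * x - 2 = 0`, which is `(x + 2) * (x ^ 2 - 2 * x - 1) = 0`; the root `-2` is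
treated next. -/
theorem tilleyGraph_exists_adjEigenvalue_of_quadratic {x : ℝ} (hx : x ^ 2 = 2 * x + 1) :
    ∃ i, tilleyGraph.adjEigenvalue i = x := by
  refine exists_adjEigenvalue_eq _ (v := ![2, -2, 0, x, x, 0, -x, -x, 0, x ^ 2 - x - 2, 0,
    -(x ^ 2 - x - 2)]) (fun h => by simpa using congrFun h 0) ?_
  rw [tilleyGraph_adjMatrix_mulVec]
  funext i
  fin_cases i <;> simp <;>
    first | ring1 | linear_combination (x + 2) * hx | linear_combination (-x - 2) * hx

theorem tilleyGraph_exists_adjEigenvalue_eq_neg_two :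
    ∃ i, tilleyGraph.adjEigenvalue i = -2 := by
  refine exists_adjEigenvalue_eq _ (v := ![1, -1, 0, -1, -1, 0, 1, 1, 0, 2, 0, -2])
    (fun h => by simpa using congrFun h 0) ?_
  rw [tilleyGraph_adjMatrix_mulVec]
  funext i
  fin_cases i <;> simp <;> norm_num

theorem tilleyGraph_exists_adjEigenvalue_of_sq {x : ℝ} (hx : x ^ 2 = 5) :
    ∃ i, tilleyGraph.adjEigenvalue i = x := by
  refine exists_adjEigenvalue_eq _ (v := ![0, 0, 2, x - 1, 1 - x, -2, 1 - x, x - 1, 2, 0, -2, 0])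
    (fun h => by simpa using congrFun h 2) ?_
  rw [tilleyGraph_adjMatrix_mulVec]
  funext i
  fin_cases i <;> simp <;> first | ring1 | linear_combination hx | linear_combination -hx

theorem tilleyGraph_exists_adjEigenvalue_eq_neg_one :
    ∃ i, tilleyGraph.adjEigenvalue i = -1 := by
  refine exists_adjEigenvalue_eq _ (v := ![0, 0, 1, 0, 0, -1, 0, 0, -1, 0, 1, 0])
    (fun h => by simpa using congrFun h 2) ?_
  rw [tilleyGraph_adjMatrix_mulVec]
  funext i
  fin_cases i <;> simp

/-! ### Determination of the full spectrum -/

/-- The sum and the square sum of four distinct roots of the quartic factor of the characteristic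
polynomial. -/
theorem sum_roots_quartic {a b c d : ℝ}
    (ha : a ^ 4 - 3 * a ^ 3 - 13 * a ^ 2 + 13 * a + 30 = 0)
    (hb : b ^ 4 - 3 * b ^ 3 - 13 * b ^ 2 + 13 * b + 30 = 0)
    (hc : c ^ 4 - 3 * c ^ 3 - 13 * c ^ 2 + 13 * c + 30 = 0)
    (hd : d ^ 4 - 3 * d ^ 3 - 13 * d ^ 2 + 13 * d + 30 = 0)
    (hab : b < a) (hbc : c < b) (hcd : d < c) :
    a + b + c + d = 3 ∧ a ^ 2 + b ^ 2 + c ^ 2 + d ^ 2 = 35 := by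
  -- Iterated divided differences of the quartic vanish at distinct roots; the third one is the
  -- linear Vieta relation.
  have two : ∀ {x y : ℝ}, x ^ 4 - 3 * x ^ 3 - 13 * x ^ 2 + 13 * x + 30 = 0 →
      y ^ 4 - 3 * y ^ 3 - 13 * y ^ 2 + 13 * y + 30 = 0 → y < x →
      x ^ 3 + x ^ 2 * y + x * y ^ 2 + y ^ 3 - 3 * (x ^ 2 + x * y + y ^ 2) - 13 * (x + y) + 13 = 0 :=
    fun hx hy hxy => mul_left_cancel₀ (sub_ne_zero.2 hxy.ne') (by linear_combination hx - hy)
  have h3 : a ^ 2 + b ^ 2 + c ^ 2 + a * b + a * c + b * c - 3 * (a + b + c) - 13 = 0 :=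
    mul_left_cancel₀ (sub_ne_zero.2 (hbc.trans hab).ne')
      (by linear_combination two ha hb hab - two hb hc hbc)
  have h3' : b ^ 2 + c ^ 2 + d ^ 2 + b * c + b * d + c * d - 3 * (b + c + d) - 13 = 0 :=
    mul_left_cancel₀ (sub_ne_zero.2 (hcd.trans hbc).ne')
      (by linear_combination two hb hc hbc - two hc hd hcd)
  have h4 : a + b + c + d - 3 = 0 :=
    mul_left_cancel₀ (sub_ne_zero.2 (hcd.trans (hbc.trans hab)).ne')
      (by linear_combination h3 - h3')
  refine ⟨by linarith, ?_⟩
  linear_combination 2 * h3 + (d - a - b - c + 3) * h4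

/-- The hypotheses give `(x + 1) ^ 2 + (y + 1) ^ 2 = 0`. -/
theorem eq_neg_one_of_add_eq_of_sq_add_sq_eq {x y : ℝ} (h1 : x + y = -2)
    (h2 : x ^ 2 + y ^ 2 = 2) : x = -1 ∧ y = -1 := by
  have hx : (x + 1) ^ 2 = 0 :=
    le_antisymm (by linarith [sq_nonneg (y + 1)]) (sq_nonneg _)
  have hx' : x + 1 = 0 := pow_eq_zero_iff two_ne_zero |>.1 hx
  exact ⟨by linarith, by linarith⟩

/-- The quartic changes sign on each interval; the primed intermediate value theorem serves the two
falling crossings. -/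
theorem exists_roots_quartic : ∃ a b c d : ℝ,
    (a ^ 4 - 3 * a ^ 3 - 13 * a ^ 2 + 13 * a + 30 = 0 ∧
      b ^ 4 - 3 * b ^ 3 - 13 * b ^ 2 + 13 * b + 30 = 0 ∧
      c ^ 4 - 3 * c ^ 3 - 13 * c ^ 2 + 13 * c + 30 = 0 ∧
      d ^ 4 - 3 * d ^ 3 - 13 * d ^ 2 + 13 * d + 30 = 0) ∧
    a ∈ Set.Icc 4.862720396 4.862720397 ∧ b ∈ Set.Icc 1.905424142 1.905424143 ∧
    c ∈ Set.Icc (-1.325568666) (-1.325568665) ∧ d ∈ Set.Icc (-2.442575874) (-2.442575873) := by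
  have hcont : Continuous fun x : ℝ => x ^ 4 - 3 * x ^ 3 - 13 * x ^ 2 + 13 * x + 30 := by fun_prop
  obtain ⟨a, ha, ha0⟩ := intermediate_value_Icc (by norm_num : (4.862720396 : ℝ) ≤ 4.862720397)
    hcont.continuousOn (show (0 : ℝ) ∈ Set.Icc _ _ by constructor <;> norm_num)
  obtain ⟨b, hb, hb0⟩ := intermediate_value_Icc' (by norm_num : (1.905424142 : ℝ) ≤ 1.905424143)
    hcont.continuousOn (show (0 : ℝ) ∈ Set.Icc _ _ by constructor <;> norm_num)
  obtain ⟨c, hc, hc0⟩ := intermediate_value_Icc (by norm_num : (-1.325568666 : ℝ) ≤ -1.325568665)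
    hcont.continuousOn (show (0 : ℝ) ∈ Set.Icc _ _ by constructor <;> norm_num)
  obtain ⟨d, hd, hd0⟩ := intermediate_value_Icc' (by norm_num : (-2.442575874 : ℝ) ≤ -2.442575873)
    hcont.continuousOn (show (0 : ℝ) ∈ Set.Icc _ _ by constructor <;> norm_num)
  exact ⟨a, b, c, d, ⟨ha0, hb0, hc0, hd0⟩, ha, hb, hc, hd⟩

theorem sqrt_two_mem_Icc : √2 ∈ Set.Icc (1.414213562 : ℝ) 1.414213563 :=
  ⟨Real.le_sqrt_of_sq_le (by norm_num), Real.sqrt_le_iff.2 ⟨by norm_num, by norm_num⟩⟩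

theorem sqrt_five_mem_Icc : √5 ∈ Set.Icc (2.236067977 : ℝ) 2.236067978 :=
  ⟨Real.le_sqrt_of_sq_le (by norm_num), Real.sqrt_le_iff.2 ⟨by norm_num, by norm_num⟩⟩

/-- The spectrum of the Tilley graph. -/
theorem tilleyGraph_adjEigenvalue : ∃ a b c d : ℝ,
    (a ∈ Set.Icc 4.862720396 4.862720397 ∧ b ∈ Set.Icc 1.905424142 1.905424143 ∧
      c ∈ Set.Icc (-1.325568666) (-1.325568665) ∧
      d ∈ Set.Icc (-2.442575874) (-2.442575873)) ∧
    a + b + c + d = 3 ∧ a ^ 2 + b ^ 2 + c ^ 2 + d ^ 2 = 35 ∧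
    tilleyGraph.adjEigenvalue = ![a, 1 + √2, √5, b, 1 - √2, -1, -1, -1, c, -2, -√5, d] := by
  obtain ⟨a, b, c, d, ⟨ha0, hb0, hc0, hd0⟩, ha, hb, hc, hd⟩ := exists_roots_quartic
  refine ⟨a, b, c, d, ⟨ha, hb, hc, hd⟩, ?_⟩
  rw [Set.mem_Icc] at ha hb hc hd
  obtain ⟨h2, h2'⟩ := sqrt_two_mem_Icc
  obtain ⟨h5, h5'⟩ := sqrt_five_mem_Icc
  have hsq2 : √2 ^ 2 = (2 : ℝ) := Real.sq_sqrt (by norm_num)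
  have hsq5 : √5 ^ 2 = (5 : ℝ) := Real.sq_sqrt (by norm_num)
  obtain ⟨hsum, hsq⟩ :=
    sum_roots_quartic ha0 hb0 hc0 hd0 (by linarith) (by linarith) (by linarith)
  refine ⟨hsum, hsq, ?_⟩
  -- `-1` is listed once: distinctness of the ten values is what embeds them in the spectrum as a
  -- multiset.
  set l : List ℝ := [a, 1 + √2, √5, b, 1 - √2, -1, c, -2, -√5, d] with hl
  have hnodup : l.Nodup := by
    refine List.Pairwise.imp (R := (· > ·)) (fun h => h.ne') (List.isChain_iff_pairwise.1 ?_)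
    simp only [hl, List.isChain_cons_cons, List.isChain_singleton, gt_iff_lt, and_true]
    refine ⟨?_, ?_, ?_, ?_, ?_, ?_, ?_, ?_, ?_⟩ <;> linarith
  have hle : (l : Multiset ℝ) ≤ Finset.univ.val.map tilleyGraph.adjEigenvalue := by
    rw [Multiset.le_iff_subset (Multiset.coe_nodup.2 hnodup)]
    intro x hx
    simp only [Multiset.mem_map, Finset.mem_val, Finset.mem_univ, true_and]
    simp only [hl, Multiset.mem_coe, List.mem_cons, List.not_mem_nil, or_false] at hx
    rcases hx with rfl | rfl | rfl | rfl | rfl | rfl | rfl | rfl | rfl | rfl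
    · exact tilleyGraph_exists_adjEigenvalue_of_quartic ha0
    · exact tilleyGraph_exists_adjEigenvalue_of_quadratic (by linear_combination hsq2)
    · exact tilleyGraph_exists_adjEigenvalue_of_sq hsq5
    · exact tilleyGraph_exists_adjEigenvalue_of_quartic hb0
    · exact tilleyGraph_exists_adjEigenvalue_of_quadratic (by linear_combination hsq2)
    · exact tilleyGraph_exists_adjEigenvalue_eq_neg_one
    · exact tilleyGraph_exists_adjEigenvalue_of_quartic hc0
    · exact tilleyGraph_exists_adjEigenvalue_eq_neg_two
    · exact tilleyGraph_exists_adjEigenvalue_of_sq (by linear_combination hsq5)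
    · exact tilleyGraph_exists_adjEigenvalue_of_quartic hd0
  obtain ⟨x, y, hxy⟩ := Multiset.exists_eq_add_pair_of_card hle (by simp [hl])
  have hxy1 : x + y = -2 := by
    have h := tilleyGraph.sum_adjEigenvalue
    rw [Finset.sum_eq_multiset_sum, hxy] at h
    simp only [hl, Multiset.sum_add, Multiset.sum_coe, List.sum_cons, List.sum_nil,
      Multiset.insert_eq_cons, Multiset.sum_cons, Multiset.sum_singleton] at h
    linarith
  have hxy2 : x ^ 2 + y ^ 2 = 2 := by
    have h := tilleyGraph.sum_adjEigenvalue_sq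
    have hdeg : ∑ v, tilleyGraph.degree v = 58 := by
      simp only [← card_neighborFinset_eq_degree, tilleyGraph_neighborFinset]
      decide
    rw [← Nat.cast_sum, hdeg, Finset.sum_eq_multiset_sum,
      show (fun i => tilleyGraph.adjEigenvalue i ^ 2) = (· ^ 2) ∘ tilleyGraph.adjEigenvalue from rfl,
      ← Multiset.map_map, hxy] at h
    simp only [hl, Multiset.map_add, Multiset.map_coe, List.map_cons, List.map_nil,
      Multiset.insert_eq_cons, Multiset.map_cons, Multiset.map_singleton,
      Multiset.sum_add, Multiset.sum_coe, List.sum_cons, List.sum_nil,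
      Multiset.sum_cons, Multiset.sum_singleton] at h
    push_cast at h
    linear_combination h - hsq - 2 * hsq2 - 2 * hsq5
  obtain ⟨rfl, rfl⟩ := eq_neg_one_of_add_eq_of_sq_add_sq_eq hxy1 hxy2
  refine adjEigenvalue_eq_of_map_eq _ ?_ ?_
  · refine Fin.antitone_iff_succ_le.2 fun i => ?_
    fin_cases i <;> simp <;> linarith
  · rw [hxy, Fin.univ_val_map]
    simp only [hl, Multiset.insert_eq_cons, ← Multiset.coe_singleton, Multiset.cons_coe,
      Multiset.coe_add, Multiset.coe_eq_coe]
    -- The two recovered copies of `-1` move past the last four entries to their sorted place.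
    exact (List.perm_append_comm (l₁ := [c, -2, -√5, d]) (l₂ := [-1, -1])).append_left
      [a, 1 + √2, √5, b, 1 - √2, -1]

end SimpleGraph

/-! ### Rational bounds for real powers -/

-- Here `z` approximates `log x / N` and `w` approximates `p * log x / M`, while `c` and `c'`
-- approximate their exponentials. `N` and `M` keep the arguments of `exp` small, where ten Taylor
-- terms are sharp; all hypotheses become rational inequalities.
open Finset in
theorem rpow_le_of_exp_approx {x p z w c c' E : ℝ} {N M : ℕ} (hx : 0 ≤ x) (hp : 0 ≤ p)
    (hz : 0 ≤ z) (hw : 0 ≤ w) (hc : 0 ≤ c) (hxc : x ≤ c ^ N)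
    (hcz : c ≤ ∑ i ∈ range 10, z ^ i / i.factorial) (hzw : N * z * p ≤ M * w)
    (hwc : w ≤ 1 ∧ ∑ i ∈ range 10, w ^ i / i.factorial +
      w ^ 10 * (10 + 1) / (Nat.factorial 10 * 10) ≤ c') (hE : c' ^ M ≤ E) : x ^ p ≤ E := by
  have hxz : x ≤ Real.exp (N * z) := by
    rw [Real.exp_nat_mul]
    exact hxc.trans (pow_le_pow_left₀ hc (hcz.trans (Real.sum_le_exp_of_nonneg hz 10)) N)
  have hwc' : Real.exp w ≤ c' := by
    refine (Real.exp_bound' hw hwc.1 (n := 10) (by norm_num)).trans ?_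
    exact_mod_cast hwc.2
  calc x ^ p ≤ Real.exp (N * z) ^ p := Real.rpow_le_rpow hx hxz hp
    _ = Real.exp (N * z * p) := (Real.exp_mul _ _).symm
    _ ≤ Real.exp (M * w) := Real.exp_le_exp.2 hzw
    _ = Real.exp w ^ M := Real.exp_nat_mul _ _
    _ ≤ c' ^ M := pow_le_pow_left₀ (Real.exp_pos w).le hwc' M
    _ ≤ E := hE

open Finset in
theorem le_rpow_of_exp_approx {x p z w c c' E : ℝ} {N M : ℕ} (hp : 0 ≤ p)
    (hz : 0 ≤ z) (hz1 : z ≤ 1) (hw : 0 ≤ w) (hc' : 0 ≤ c') (hcx : c ^ N ≤ x)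
    (hzc : ∑ i ∈ range 10, z ^ i / i.factorial +
      z ^ 10 * (10 + 1) / (Nat.factorial 10 * 10) ≤ c) (hwz : M * w ≤ N * z * p)
    (hcw : c' ≤ ∑ i ∈ range 10, w ^ i / i.factorial) (hE : E ≤ c' ^ M) : E ≤ x ^ p := by
  have hzc' : Real.exp z ≤ c := by
    refine (Real.exp_bound' hz hz1 (n := 10) (by norm_num)).trans ?_
    exact_mod_cast hzc
  have hzx : Real.exp (N * z) ≤ x := by
    rw [Real.exp_nat_mul]
    exact (pow_le_pow_left₀ (Real.exp_pos z).le hzc' N).trans hcx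
  calc E ≤ c' ^ M := hE
    _ ≤ Real.exp w ^ M := pow_le_pow_left₀ hc' (hcw.trans (Real.sum_le_exp_of_nonneg hw 10)) M
    _ = Real.exp (M * w) := (Real.exp_nat_mul _ _).symm
    _ ≤ Real.exp (N * z * p) := Real.exp_le_exp.2 hwz
    _ = Real.exp (N * z) ^ p := Real.exp_mul _ _
    _ ≤ x ^ p := Real.rpow_le_rpow (Real.exp_pos _).le hzx hp

theorem rpow_mem_Icc_of_mem_Icc_4_86272 {x : ℝ} (hx : x ∈ Set.Icc 4.862720396 4.862720397) :
    x ^ (13.3466 : ℝ) ∈ Set.Icc 1470629383 1470629437 := by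
  have h0 : 0 ≤ x := le_trans (by norm_num) hx.1
  constructor
  · refine le_rpow_of_exp_approx (x := x) (z := 0.39539950809) (w := 0.32982744216) (c := 1.484977332891)
      (c' := 1.390728126711) (N := 4) (M := 64)
      ?_ ?_ ?_ ?_ ?_ ((show _ ≤ (4.862720396 : ℝ) by norm_num).trans hx.1) ?_ ?_ ?_ ?_ <;>
      norm_num [Finset.sum_range_succ, Nat.factorial]
  · refine rpow_le_of_exp_approx (x := x) (z := 0.39539950875) (w := 0.32982744272) (c := 1.484977333841)
      (c' := 1.390728127495) (N := 4) (M := 64)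
      h0 ?_ ?_ ?_ ?_ (hx.2.trans (show (4.862720397 : ℝ) ≤ _ by norm_num)) ?_ ?_ ?_ ?_ <;>
      norm_num [Finset.sum_range_succ, Nat.factorial]

theorem rpow_mem_Icc_of_mem_Icc_2_41421 {x : ℝ} (hx : x ∈ Set.Icc 2.414213562 2.414213563) :
    x ^ (13.3466 : ℝ) ∈ Set.Icc 128455.87 128455.874 := by
  have h0 : 0 ≤ x := le_trans (by norm_num) hx.1
  constructor
  · refine le_rpow_of_exp_approx (x := x) (z := 0.44068679313) (w := 0.36760439707) (c := 1.553773973445)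
      (c' := 1.444270568262) (N := 2) (M := 32)
      ?_ ?_ ?_ ?_ ?_ ((show _ ≤ (2.414213562 : ℝ) by norm_num).trans hx.1) ?_ ?_ ?_ ?_ <;>
      norm_num [Finset.sum_range_succ, Nat.factorial]
  · refine rpow_le_of_exp_approx (x := x) (z := 0.44068679394) (w := 0.36760439775) (c := 1.553773974619)
      (c' := 1.444270569258) (N := 2) (M := 32)
      h0 ?_ ?_ ?_ ?_ (hx.2.trans (show (2.414213563 : ℝ) ≤ _ by norm_num)) ?_ ?_ ?_ ?_ <;>
      norm_num [Finset.sum_range_succ, Nat.factorial]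

theorem rpow_mem_Icc_of_mem_Icc_2_23607 {x : ℝ} (hx : x ∈ Set.Icc 2.236067977 2.236067978) :
    x ^ (13.3466 : ℝ) ∈ Set.Icc 46178.1494 46178.1506 := by
  have h0 : 0 ≤ x := le_trans (by norm_num) hx.1
  constructor
  · refine le_rpow_of_exp_approx (x := x) (z := 0.40235947769) (w := 0.3356331878) (c := 1.495348780598)
      (c' := 1.398825824309) (N := 2) (M := 32)
      ?_ ?_ ?_ ?_ ?_ ((show _ ≤ (2.236067977 : ℝ) by norm_num).trans hx.1) ?_ ?_ ?_ ?_ <;>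
      norm_num [Finset.sum_range_succ, Nat.factorial]
  · refine rpow_le_of_exp_approx (x := x) (z := 0.40235947853) (w := 0.33563318851) (c := 1.495348781819)
      (c' := 1.398825825309) (N := 2) (M := 32)
      h0 ?_ ?_ ?_ ?_ (hx.2.trans (show (2.236067978 : ℝ) ≤ _ by norm_num)) ?_ ?_ ?_ ?_ <;>
      norm_num [Finset.sum_range_succ, Nat.factorial]

theorem rpow_mem_Icc_of_mem_Icc_1_90542 {x : ℝ} (hx : x ∈ Set.Icc 1.905424142 1.905424143) :
    x ^ (13.3466 : ℝ) ∈ Set.Icc 5456.78361 5456.78375 := by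
  have h0 : 0 ≤ x := le_trans (by norm_num) hx.1
  constructor
  · refine le_rpow_of_exp_approx (x := x) (z := 0.32235231495) (w := 0.26889421291) (c := 1.380371015644)
      (c' := 1.308516709548) (N := 2) (M := 32)
      ?_ ?_ ?_ ?_ ?_ ((show _ ≤ (1.905424142 : ℝ) by norm_num).trans hx.1) ?_ ?_ ?_ ?_ <;>
      norm_num [Finset.sum_range_succ, Nat.factorial]
  · refine rpow_le_of_exp_approx (x := x) (z := 0.32235231583) (w := 0.26889421366) (c := 1.380371016854)
      (c' := 1.308516710531) (N := 2) (M := 32)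
      h0 ?_ ?_ ?_ ?_ (hx.2.trans (show (1.905424143 : ℝ) ≤ _ by norm_num)) ?_ ?_ ?_ ?_ <;>
      norm_num [Finset.sum_range_succ, Nat.factorial]

theorem rpow_mem_Icc_of_mem_Icc_1_32557 {x : ℝ} (hx : x ∈ Set.Icc 1.325568665 1.325568666) :
    x ^ (13.3466 : ℝ) ∈ Set.Icc 43.0183344 43.0183353 := by
  have h0 : 0 ≤ x := le_trans (by norm_num) hx.1
  constructor
  · refine le_rpow_of_exp_approx (x := x) (z := 0.28184154819) (w := 0.23510165044) (c := 1.325568664592)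
      (c' := 1.2650373538) (N := 1) (M := 16)
      ?_ ?_ ?_ ?_ ?_ ((show _ ≤ (1.325568665 : ℝ) by norm_num).trans hx.1) ?_ ?_ ?_ ?_ <;>
      norm_num [Finset.sum_range_succ, Nat.factorial]
  · refine rpow_le_of_exp_approx (x := x) (z := 0.28184154956) (w := 0.23510165159) (c := 1.325568666406)
      (c' := 1.265037355256) (N := 1) (M := 16)
      h0 ?_ ?_ ?_ ?_ (hx.2.trans (show (1.325568666 : ℝ) ≤ _ by norm_num)) ?_ ?_ ?_ ?_ <;>
      norm_num [Finset.sum_range_succ, Nat.factorial]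

theorem rpow_mem_Icc_of_mem_Icc_2 {x : ℝ} (hx : x ∈ Set.Icc 2 2) :
    x ^ (13.3466 : ℝ) ∈ Set.Icc 10416.6227 10416.623 := by
  have h0 : 0 ≤ x := le_trans (by norm_num) hx.1
  constructor
  · refine le_rpow_of_exp_approx (x := x) (z := 0.34657358997) (w := 0.28909869224) (c := 1.414213561936)
      (c' := 1.335223498222) (N := 2) (M := 32)
      ?_ ?_ ?_ ?_ ?_ ((show _ ≤ (2 : ℝ) by norm_num).trans hx.1) ?_ ?_ ?_ ?_ <;>
      norm_num [Finset.sum_range_succ, Nat.factorial]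
  · refine rpow_le_of_exp_approx (x := x) (z := 0.34657359058) (w := 0.28909869276) (c := 1.41421356279)
      (c' := 1.335223498919) (N := 2) (M := 32)
      h0 ?_ ?_ ?_ ?_ (hx.2.trans (show (2 : ℝ) ≤ _ by norm_num)) ?_ ?_ ?_ ?_ <;>
      norm_num [Finset.sum_range_succ, Nat.factorial]

theorem rpow_mem_Icc_of_mem_Icc_2_44258 {x : ℝ} (hx : x ∈ Set.Icc 2.442575873 2.442575874) :
    x ^ (13.3466 : ℝ) ∈ Set.Icc 150124.976 150124.981 := by
  have h0 : 0 ≤ x := le_trans (by norm_num) hx.1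
  constructor
  · refine le_rpow_of_exp_approx (x := x) (z := 0.44652658375) (w := 0.37247573141) (c := 1.562874234067)
      (c' := 1.451323257132) (N := 2) (M := 32)
      ?_ ?_ ?_ ?_ ?_ ((show _ ≤ (2.442575873 : ℝ) by norm_num).trans hx.1) ?_ ?_ ?_ ?_ <;>
      norm_num [Finset.sum_range_succ, Nat.factorial]
  · refine rpow_le_of_exp_approx (x := x) (z := 0.44652658457) (w := 0.37247573211) (c := 1.562874235252)
      (c' := 1.451323258164) (N := 2) (M := 32)
      h0 ?_ ?_ ?_ ?_ (hx.2.trans (show (2.442575874 : ℝ) ≤ _ by norm_num)) ?_ ?_ ?_ ?_ <;>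
      norm_num [Finset.sum_range_succ, Nat.factorial]

/-- With `le_rpow_2_051145`, this traps the energy ratio between powers with exponent `p - 1 =
12.3466`, in place of extracting a root. -/
theorem rpow_2_051135_le : (2.051135 : ℝ) ^ (12.3466 : ℝ) ≤ 7113.25132 := by
  refine rpow_le_of_exp_approx (z := 0.35919664954) (w := 0.27717858458) (c := 1.432178411097)
      (c' := 1.319401974845) (N := 2) (M := 32)
      ?_ ?_ ?_ ?_ ?_ ?_ ?_ ?_ ?_ ?_ <;>
    norm_num [Finset.sum_range_succ, Nat.factorial]

theorem le_rpow_2_051145 : 7113.67939 ≤ (2.051145 : ℝ) ^ (12.3466 : ℝ) := by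
  refine le_rpow_of_exp_approx (z := 0.3591990866) (w := 0.27718046516) (c := 1.432181901417)
      (c' := 1.319404456086) (N := 2) (M := 32)
      ?_ ?_ ?_ ?_ ?_ ?_ ?_ ?_ ?_ ?_ <;>
    norm_num [Finset.sum_range_succ, Nat.factorial]

namespace SimpleGraph

/-! ### Energies and inertia of the Tilley graph -/

section

variable {a b c d : ℝ}

theorem tilleyGraph_filter_pos
    (h : tilleyGraph.adjEigenvalue = ![a, 1 + √2, √5, b, 1 - √2, -1, -1, -1, c, -2, -√5, d])
    (ha : 0 < a) (hb : 0 < b) (hc : c < 0) (hd : d < 0) :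
    (Finset.univ.filter fun i => 0 < tilleyGraph.adjEigenvalue i) = {0, 1, 2, 3} := by
  have h2 : 1 < √2 := Real.one_lt_sqrt_two
  have h2' : 0 < 1 + √2 := by linarith
  ext i
  rw [h]
  fin_cases i <;> simp [ha, hb, hc.le, hd.le, h2.le, h2']

theorem tilleyGraph_filter_neg
    (h : tilleyGraph.adjEigenvalue = ![a, 1 + √2, √5, b, 1 - √2, -1, -1, -1, c, -2, -√5, d])
    (ha : 0 < a) (hb : 0 < b) (hc : c < 0) (hd : d < 0) :
    (Finset.univ.filter fun i => tilleyGraph.adjEigenvalue i < 0) =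
      {4, 5, 6, 7, 8, 9, 10, 11} := by
  have h2 : 1 < √2 := Real.one_lt_sqrt_two
  have h2' : 0 ≤ 1 + √2 := by linarith
  ext i
  rw [h]
  fin_cases i <;> simp [ha.le, hb.le, hc, hd, h2, h2']

theorem tilleyGraph_inertiaBound
    (h : tilleyGraph.adjEigenvalue = ![a, 1 + √2, √5, b, 1 - √2, -1, -1, -1, c, -2, -√5, d])
    (ha : 0 < a) (hb : 0 < b) (hc : c < 0) (hd : d < 0) : tilleyGraph.inertiaBound = 3 := by
  have hpos : tilleyGraph.posInertia = 4 := by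
    rw [posInertia, tilleyGraph_filter_pos h ha hb hc hd]
    rfl
  have hneg : tilleyGraph.negInertia = 8 := by
    rw [negInertia, tilleyGraph_filter_neg h ha hb hc hd]
    rfl
  rw [inertiaBound, hpos, hneg]
  norm_num

theorem tilleyGraph_posEnergy
    (h : tilleyGraph.adjEigenvalue = ![a, 1 + √2, √5, b, 1 - √2, -1, -1, -1, c, -2, -√5, d])
    (ha : 0 < a) (hb : 0 < b) (hc : c < 0) (hd : d < 0) (p : ℝ) :
    tilleyGraph.posEnergy p = a ^ p + (1 + √2) ^ p + √5 ^ p + b ^ p := by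
  rw [posEnergy, tilleyGraph_filter_pos h ha hb hc hd, h]
  simp [add_assoc]

theorem tilleyGraph_negEnergy
    (h : tilleyGraph.adjEigenvalue = ![a, 1 + √2, √5, b, 1 - √2, -1, -1, -1, c, -2, -√5, d])
    (ha : 0 < a) (hb : 0 < b) (hc : c < 0) (hd : d < 0) (p : ℝ) :
    tilleyGraph.negEnergy p =
      (√2 - 1) ^ p + 3 + (-c) ^ p + 2 ^ p + √5 ^ p + (-d) ^ p := by
  have h2 : |1 - √2| = √2 - 1 := by
    rw [abs_sub_comm, abs_of_pos (sub_pos.2 Real.one_lt_sqrt_two)]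
  rw [negEnergy, tilleyGraph_filter_neg h ha hb hc hd, h]
  simp [h2, abs_of_neg hc, abs_of_neg hd, abs_of_nonneg (Real.sqrt_nonneg 5)]
  ring

/-- One-decimal enclosures of the squares suffice, the energies being near 38.1 and 19.9. -/
theorem tilleyGraph_squareEnergyBound_mem
    (h : tilleyGraph.adjEigenvalue = ![a, 1 + √2, √5, b, 1 - √2, -1, -1, -1, c, -2, -√5, d])
    (ha : a ∈ Set.Icc 4.862720396 4.862720397) (hb : b ∈ Set.Icc 1.905424142 1.905424143)
    (hc : c ∈ Set.Icc (-1.325568666) (-1.325568665))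
    (hd : d ∈ Set.Icc (-2.442575874) (-2.442575873)) :
    tilleyGraph.squareEnergyBound ∈ Set.Ioc 2 3 := by
  rw [Set.mem_Icc] at ha hb hc hd
  obtain ⟨h2, h2'⟩ := sqrt_two_mem_Icc
  have hsq2 : √2 ^ 2 = (2 : ℝ) := Real.sq_sqrt (by norm_num)
  have hsq5 : √5 ^ 2 = (5 : ℝ) := Real.sq_sqrt (by norm_num)
  have ha' : a ^ 2 ∈ Set.Icc (23.6 : ℝ) 23.7 := ⟨by nlinarith, by nlinarith⟩
  have hb' : b ^ 2 ∈ Set.Icc (3.6 : ℝ) 3.7 := ⟨by nlinarith, by nlinarith⟩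
  have hc' : c ^ 2 ∈ Set.Icc (1.7 : ℝ) 1.8 := ⟨by nlinarith, by nlinarith⟩
  have hd' : d ^ 2 ∈ Set.Icc (5.9 : ℝ) 6 := ⟨by nlinarith, by nlinarith⟩
  rw [Set.mem_Icc] at ha' hb' hc' hd'
  have hpos : tilleyGraph.posEnergy 2 ∈ Set.Icc (38 : ℝ) 38.3 := by
    rw [tilleyGraph_posEnergy h (by linarith) (by linarith) (by linarith) (by linarith)]
    simp only [Real.rpow_two]
    constructor <;> linarith
  have hneg : tilleyGraph.negEnergy 2 ∈ Set.Icc (19.7 : ℝ) 20 := by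
    rw [tilleyGraph_negEnergy h (by linarith) (by linarith) (by linarith) (by linarith)]
    simp only [Real.rpow_two, neg_sq]
    constructor <;> linarith
  rw [Set.mem_Icc] at hpos hneg
  have hn0 : 0 < tilleyGraph.negEnergy 2 := by linarith
  have hp0 : 0 < tilleyGraph.posEnergy 2 := by linarith
  rw [squareEnergyBound, energyRatio]
  constructor
  · have : 1 < tilleyGraph.posEnergy 2 / tilleyGraph.negEnergy 2 := by
      rw [one_lt_div hn0]
      linarith
    linarith [this.trans_le (le_max_left _ (tilleyGraph.negEnergy 2 / tilleyGraph.posEnergy 2))]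
  · have : max (tilleyGraph.posEnergy 2 / tilleyGraph.negEnergy 2)
        (tilleyGraph.negEnergy 2 / tilleyGraph.posEnergy 2) ≤ 2 := by
      rw [max_le_iff, div_le_iff₀ hn0, div_le_iff₀ hp0]
      constructor <;> linarith
    linarith

theorem tilleyGraph_pEnergyBound_mem
    (h : tilleyGraph.adjEigenvalue = ![a, 1 + √2, √5, b, 1 - √2, -1, -1, -1, c, -2, -√5, d])
    (ha : a ∈ Set.Icc 4.862720396 4.862720397) (hb : b ∈ Set.Icc 1.905424142 1.905424143)
    (hc : c ∈ Set.Icc (-1.325568666) (-1.325568665))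
    (hd : d ∈ Set.Icc (-2.442575874) (-2.442575873)) :
    tilleyGraph.pEnergyBound 13.3466 ∈ Set.Icc 3.051135 3.051145 := by
  rw [Set.mem_Icc] at ha hb hc hd
  obtain ⟨h2, h2'⟩ := sqrt_two_mem_Icc
  have epos := tilleyGraph_posEnergy h (by linarith) (by linarith) (by linarith) (by linarith)
    13.3466
  have eneg := tilleyGraph_negEnergy h (by linarith) (by linarith) (by linarith) (by linarith)
    13.3466
  obtain ⟨ra, ra'⟩ := rpow_mem_Icc_of_mem_Icc_4_86272 ha
  obtain ⟨rs, rs'⟩ := rpow_mem_Icc_of_mem_Icc_2_41421 (x := 1 + √2)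
    ⟨by linarith, by linarith⟩
  obtain ⟨rf, rf'⟩ := rpow_mem_Icc_of_mem_Icc_2_23607 sqrt_five_mem_Icc
  obtain ⟨rb, rb'⟩ := rpow_mem_Icc_of_mem_Icc_1_90542 hb
  obtain ⟨rc, rc'⟩ := rpow_mem_Icc_of_mem_Icc_1_32557 (x := -c) ⟨by linarith, by linarith⟩
  obtain ⟨rt, rt'⟩ := rpow_mem_Icc_of_mem_Icc_2 (x := 2) ⟨le_rfl, le_rfl⟩
  obtain ⟨rd, rd'⟩ := rpow_mem_Icc_of_mem_Icc_2_44258 (x := -d) ⟨by linarith, by linarith⟩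
  have r0 : 0 ≤ (√2 - 1) ^ (13.3466 : ℝ) := Real.rpow_nonneg (by linarith) _
  -- This term is negligible; as the base is below 1, lowering the exponent to 10 only enlarges it.
  have r0' : (√2 - 1) ^ (13.3466 : ℝ) ≤ 0.001 :=
    calc (√2 - 1) ^ (13.3466 : ℝ) ≤ (√2 - 1) ^ ((10 : ℕ) : ℝ) :=
          Real.rpow_le_rpow_of_exponent_ge (by linarith) (by linarith) (by norm_num)
      _ = (√2 - 1) ^ 10 := Real.rpow_natCast _ _
      _ ≤ 0.5 ^ 10 := pow_le_pow_left₀ (by linarith) (by linarith) _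
      _ ≤ 0.001 := by norm_num
  set A := tilleyGraph.posEnergy 13.3466
  set B := tilleyGraph.negEnergy 13.3466
  have hB : 0 < B := by linarith
  have hA : 0 < A := by linarith
  have hlow : 7113.25132 ≤ A / B := by
    rw [le_div_iff₀ hB]
    linarith
  have hupp : A / B ≤ 7113.67939 := by
    rw [div_le_iff₀ hB]
    linarith
  have hratio : tilleyGraph.energyRatio 13.3466 = A / B := by
    have h1 : B / A ≤ 1 := (div_le_one hA).2 (by linarith)
    exact max_eq_left (h1.trans (le_trans (by norm_num) hlow))
  have hexp : 1 / |(13.3466 : ℝ) - 1| = (12.3466 : ℝ)⁻¹ := by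
    rw [abs_of_pos (by norm_num)]
    norm_num
  have hl : 2.051135 ≤ (A / B) ^ (12.3466 : ℝ)⁻¹ :=
    (Real.le_rpow_inv_iff_of_pos (by norm_num) (by linarith) (by norm_num)).2
      (rpow_2_051135_le.trans hlow)
  have hu : (A / B) ^ (12.3466 : ℝ)⁻¹ ≤ 2.051145 :=
    (Real.rpow_inv_le_iff_of_pos (by linarith) (by norm_num) (by norm_num)).2
      (hupp.trans le_rpow_2_051145)
  rw [pEnergyBound, hratio, hexp]
  constructor <;> linarith

theorem tilleyGraph_eigenvalueSumBound_one
    (h : tilleyGraph.adjEigenvalue = ![a, 1 + √2, √5, b, 1 - √2, -1, -1, -1, c, -2, -√5, d]) :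
    tilleyGraph.eigenvalueSumBound 1 = 1 + a / -d := by
  have h0 : (Finset.univ.filter fun i : Fin 12 => i.val < 1) = {0} := by decide
  have h11 : (Finset.univ.filter fun i : Fin 12 => 12 ≤ i.val + 1) = {11} := by decide
  rw [eigenvalueSumBound, h0, h11, h]
  simp

theorem tilleyGraph_eigenvalueSumBound_le
    (h : tilleyGraph.adjEigenvalue = ![a, 1 + √2, √5, b, 1 - √2, -1, -1, -1, c, -2, -√5, d])
    (ha : a ∈ Set.Icc 4.862720396 4.862720397) (hb : b ∈ Set.Icc 1.905424142 1.905424143)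
    (hc : c ∈ Set.Icc (-1.325568666) (-1.325568665))
    (hd : d ∈ Set.Icc (-2.442575874) (-2.442575873)) {m : ℕ} (hm : m ∈ Set.Icc 2 11) :
    tilleyGraph.eigenvalueSumBound m ≤ 2.9 := by
  rw [Set.mem_Icc] at ha hb hc hd
  obtain ⟨h2, h2'⟩ := sqrt_two_mem_Icc
  obtain ⟨h5, h5'⟩ := sqrt_five_mem_Icc
  -- The threshold 2.9 is a convenient value below the Hoffman bound 2.9908.
  have key : ∀ {x y : ℝ}, 0 < y → x ≤ 1.9 * y → 1 + x / y ≤ 2.9 := fun hy hxy => by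
    have := (div_le_iff₀ hy).2 hxy
    linarith
  obtain ⟨hm1, hm2⟩ := hm
  rw [eigenvalueSumBound, h]
  interval_cases m <;> refine key ?_ ?_ <;>
    simp [Finset.sum_filter, Fin.sum_univ_succ] <;> linarith

end

end SimpleGraph

open SimpleGraph in
theorem mainTheorem4 :
    -- basic data of the graph
    (¬ ∃ d : ℕ, SimpleGraph.tilleyGraph.IsRegularOfDegree d) ∧
    SimpleGraph.tilleyGraph.cliqueNum = 3 ∧
    SimpleGraph.tilleyGraph.chromaticNumber = 4 ∧
    -- the spectrum, exact where it is given exactly and rounded to five decimals elsewhere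
    |SimpleGraph.tilleyGraph.adjEigenvalue 0 - 4.86272| ≤ 0.000005 ∧
    SimpleGraph.tilleyGraph.adjEigenvalue 1 = 1 + √2 ∧
    SimpleGraph.tilleyGraph.adjEigenvalue 2 = √5 ∧
    |SimpleGraph.tilleyGraph.adjEigenvalue 3 - 1.90542| ≤ 0.000005 ∧
    SimpleGraph.tilleyGraph.adjEigenvalue 4 = 1 - √2 ∧
    SimpleGraph.tilleyGraph.adjEigenvalue 5 = -1 ∧
    SimpleGraph.tilleyGraph.adjEigenvalue 6 = -1 ∧
    SimpleGraph.tilleyGraph.adjEigenvalue 7 = -1 ∧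
    |SimpleGraph.tilleyGraph.adjEigenvalue 8 - (-1.32557)| ≤ 0.000005 ∧
    SimpleGraph.tilleyGraph.adjEigenvalue 9 = -2 ∧
    SimpleGraph.tilleyGraph.adjEigenvalue 10 = -√5 ∧
    |SimpleGraph.tilleyGraph.adjEigenvalue 11 - (-2.44258)| ≤ 0.000005 ∧
    -- the earlier spectral bounds, none of which gives more than 3
    IsGreatest (SimpleGraph.tilleyGraph.eigenvalueSumBound '' Set.Icc 1 11)
      (1 + SimpleGraph.tilleyGraph.adjEigenvalue 0 /
        (-SimpleGraph.tilleyGraph.adjEigenvalue 11)) ∧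
    |1 + SimpleGraph.tilleyGraph.adjEigenvalue 0 /
        (-SimpleGraph.tilleyGraph.adjEigenvalue 11) - 2.99082| ≤ 0.000005 ∧
    ⌈1 + SimpleGraph.tilleyGraph.adjEigenvalue 0 /
        (-SimpleGraph.tilleyGraph.adjEigenvalue 11)⌉ = 3 ∧
    ⌈SimpleGraph.tilleyGraph.squareEnergyBound⌉ = 3 ∧
    SimpleGraph.tilleyGraph.inertiaBound = 3 ∧
    -- the `p`-energy bound and the quantum chromatic number
    |SimpleGraph.tilleyGraph.pEnergyBound 13.3466 - 3.05114| ≤ 0.000005 ∧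
    3 < SimpleGraph.tilleyGraph.pEnergyBound 13.3466 ∧
    ⌈SimpleGraph.tilleyGraph.pEnergyBound 13.3466⌉₊ = 4 ∧
    (⌈SimpleGraph.tilleyGraph.pEnergyBound 13.3466⌉₊ : ℕ∞) ≤
      SimpleGraph.tilleyGraph.quantumChromaticNumber ∧
    SimpleGraph.tilleyGraph.quantumChromaticNumber = 4 := by
  obtain ⟨a, b, c, d, ⟨ha, hb, hc, hd⟩, -, -, h⟩ := tilleyGraph_adjEigenvalue
  have hbound := tilleyGraph_pEnergyBound_mem h ha hb hc hd
  have hsquare := tilleyGraph_squareEnergyBound_mem h ha hb hc hd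
  have hone := tilleyGraph_eigenvalueSumBound_one h
  have hle := fun m => tilleyGraph_eigenvalueSumBound_le h ha hb hc hd (m := m)
  rw [Set.mem_Icc] at ha hb hc hd hbound
  have hinertia := tilleyGraph_inertiaBound h (by linarith) (by linarith) (by linarith)
    (by linarith)
  have hlow : 1.990815 ≤ a / -d := by
    rw [le_div_iff₀ (by linarith)]
    linarith
  have hupp : a / -d ≤ 1.990825 := by
    rw [div_le_iff₀ (by linarith)]
    linarith
  have hceil : ⌈tilleyGraph.pEnergyBound 13.3466⌉₊ = 4 := by
    rw [Nat.ceil_eq_iff (by norm_num)]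
    constructor <;> norm_num <;> linarith
  have e0 : tilleyGraph.adjEigenvalue 0 = a := congrFun h 0
  have e11 : tilleyGraph.adjEigenvalue 11 = d := congrFun h 11
  refine ⟨tilleyGraph_not_isRegular, tilleyGraph_cliqueNum, tilleyGraph_chromaticNumber,
    ?_, congrFun h 1, congrFun h 2, ?_, congrFun h 4, congrFun h 5, congrFun h 6, congrFun h 7,
    ?_, congrFun h 9, congrFun h 10, ?_, ?_, ?_, ?_, ?_, hinertia, ?_, ?_, hceil, ?_,
    tilleyGraph_quantumChromaticNumber⟩
  · rw [e0, abs_le]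
    constructor <;> linarith
  · rw [show tilleyGraph.adjEigenvalue 3 = b from congrFun h 3, abs_le]
    constructor <;> linarith
  · rw [show tilleyGraph.adjEigenvalue 8 = c from congrFun h 8, abs_le]
    constructor <;> linarith
  · rw [e11, abs_le]
    constructor <;> linarith
  · rw [e0, e11, ← hone]
    refine ⟨Set.mem_image_of_mem _ (by norm_num), ?_⟩
    rintro _ ⟨m, ⟨hm1, hm2⟩, rfl⟩
    rcases hm1.eq_or_lt with rfl | hm
    · exact le_rfl
    · linarith [hle m ⟨hm, hm2⟩]
  · rw [e0, e11, abs_le]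
    constructor <;> linarith
  · rw [e0, e11, Int.ceil_eq_iff]
    constructor <;> norm_num <;> linarith
  · rw [Int.ceil_eq_iff]
    obtain ⟨h1, h2⟩ := hsquare
    constructor <;> norm_num <;> linarith
  · rw [abs_le]
    constructor <;> linarith
  · linarith
  -- The inequality is read off from the exact value 4 on both sides, not from a general p-energy
  -- theorem.
  · rw [hceil, tilleyGraph_quantumChromaticNumber]
    rfl
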